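/- Let $R_2=\mathbb{Z}[u_1^{\pm1},u_2^{\pm1}]$ and $\mathfrak p=\langle 2,\,1+u_1+u_2+u_2^2\rangle\subset R_2$. Let $X$ be the compact abelian group that is the Pontryagin dual of the discrete abelian group $M=R_2/\mathfrak p$, let $\mu$ be its normalised Haar measure, and for $\mathbf n=(n_1,n_2)\in\mathbb{Z}^2$ let $\alpha^{\mathbf n}:X\to X$ be the automorphism dual to multiplication by $u^{\mathbf n}=u_1^{n_1}u_2^{n_2}$ on $M$. For $r\ge 0$, say that $\alpha$ is mixing of order $r$ if for every sequence $(\mathbf n_1^{(j)},\dots,\mathbf n_r^{(j)})_{j\ge 0}$ of $r$-tuples in $\mathbb{Z}^2$ with $\mathbf n_s^{(j)}-\mathbf n_t^{(j)}\to\infty$ as $j\to\infty$ for all $s\ne t$, and all measurable sets $A_1,\dots,A_r\subseteq X$, $$\lim_{j\to\infty}\mu\left(\alpha^{-\mathbf n_1^{(j)}}(A_1)\cap\dots\cap\alpha^{-\mathbf n_r^{(j)}}(A_r)\right)=\mu(A_1)\cdots\mu(A_r).$$ Then $\alpha$ has order of mixing exactly $3$: it is mixing of order $3$, and it is not mixing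 of order $r$ for any $r>3$. -/

import Mathlib

open Filter Topology MeasureTheory

noncomputable section

/-! ### Mixing for actions of `ℤ^d` -/

/-- A sequence `j ↦ (n₁⁽ʲ⁾, …, n_r⁽ʲ⁾)` of `r`-tuples in `ℤ^d` moves apart if
`n_s⁽ʲ⁾ - n_t⁽ʲ⁾ → ∞` (it leaves every finite subset of `ℤ^d`) for all `s ≠ t`. -/
def MovesApart {d r : ℕ} (n : ℕ → Fin r → (Fin d → ℤ)) : Prop :=
  ∀ s t : Fin r, s ≠ t → Tendsto (fun j => n j s - n j t) atTop cofinite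

/-- The mixing property of a sequence of `r`-tuples in `ℤ^d`, for a family `α` of self-maps of a
measure space: `μ (⋂ₛ α^{-n_s⁽ʲ⁾} Aₛ) → ∏ₛ μ (Aₛ)` for all measurable sets `A₁, …, A_r`. -/
def IsMixingAlong {d r : ℕ} {X : Type*} [MeasurableSpace X] (μ : Measure X)
    (α : (Fin d → ℤ) → X → X) (n : ℕ → Fin r → (Fin d → ℤ)) : Prop :=
  ∀ A : Fin r → Set X, (∀ s, MeasurableSet (A s)) →
    Tendsto (fun j => μ (⋂ s, α (n j s) ⁻¹' A s)) atTop (𝓝 (∏ s, μ (A s)))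

/-- `α` is mixing of order `r` if every sequence of `r`-tuples that moves apart is mixing. -/
def MixingOfOrder {d : ℕ} {X : Type*} [MeasurableSpace X] (μ : Measure X)
    (α : (Fin d → ℤ) → X → X) (r : ℕ) : Prop :=
  ∀ n : ℕ → Fin r → (Fin d → ℤ), MovesApart n → IsMixingAlong μ α n

/-- The (finite) order of mixing of `α` is `k`: the maximal `r` for which `α` is mixing of
order `r` exists and equals `k`. -/
def HasOrderOfMixing {d : ℕ} {X : Type*} [MeasurableSpace X] (μ : Measure X)
    (α : (Fin d → ℤ) → X → X) (k : ℕ) : Prop :=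
  IsGreatest {r : ℕ | MixingOfOrder μ α r} k

/-! ### The compact dual group of a discrete abelian group -/

/-- The abelian group `M`, written multiplicatively and carrying the discrete topology. -/
def DiscreteMul (M : Type*) : Type _ := Multiplicative M

instance (M : Type*) [AddCommGroup M] : CommGroup (DiscreteMul M) :=
  inferInstanceAs (CommGroup (Multiplicative M))

instance (M : Type*) : TopologicalSpace (DiscreteMul M) := ⊥

instance (M : Type*) : DiscreteTopology (DiscreteMul M) := ⟨rfl⟩

/-- The compact group `X_M`: the Pontryagin dual (character group) of the discrete group `M`. -/
abbrev DiscreteDual (M : Type*) [AddCommGroup M] : Type _ := PontryaginDual (DiscreteMul M)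

namespace DiscreteDual

instance (M : Type*) [AddCommGroup M] : MeasurableSpace (DiscreteDual M) := borel _

instance (M : Type*) [AddCommGroup M] : BorelSpace (DiscreteDual M) := ⟨rfl⟩

/-- The Haar measure of the compact group `X_M`, of total mass one. -/
def haar (M : Type*) [AddCommGroup M] : Measure (DiscreteDual M) :=
  Measure.haarMeasure (⊤ : TopologicalSpace.PositiveCompacts (DiscreteDual M))

/-- The measure `haar M` is a probability measure. -/
theorem haar_univ (M : Type*) [AddCommGroup M] : haar M Set.univ = 1 := by
  simpa [haar] using
    (Measure.haarMeasure_self (K₀ := (⊤ : TopologicalSpace.PositiveCompacts (DiscreteDual M))))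

/-- The continuous endomorphism `χ ↦ χ ∘ φ` of `X_M` that is dual to an endomorphism `φ` of `M`. -/
def dualMap {M : Type*} [AddCommGroup M] (φ : M →+ M) : DiscreteDual M →ₜ* DiscreteDual M :=
  PontryaginDual.map
    (⟨AddMonoidHom.toMultiplicative φ, continuous_of_discreteTopology⟩ :
      DiscreteMul M →ₜ* DiscreteMul M)

end DiscreteDual

/-! ### The algebraic `ℤ^d`-action of a module over the ring of Laurent polynomials -/

/-- The ring `R_d = ℤ[u₁^{±1}, …, u_d^{±1}]`, the group ring of `ℤ^d`. -/
abbrev LaurentRing (d : ℕ) : Type := AddMonoidAlgebra ℤ (Fin d → ℤ)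

/-- The Laurent monomial `u^n = u₁^{n₁} ⋯ u_d^{n_d}`. -/
def laurentMonomial {d : ℕ} (n : Fin d → ℤ) : LaurentRing d := AddMonoidAlgebra.single n 1

/-- The variable `u_{i+1}` (the variables are indexed from `0`). -/
def laurentVar {d : ℕ} (i : Fin d) : LaurentRing d := laurentMonomial (Pi.single i 1)

/-- The algebraic `ℤ^d`-action `α_M` on the compact dual group of the `R_d`-module `M`: `α_M^n` is
dual to multiplication by `u^n` on `M`. -/
def algebraicAction {d : ℕ} (M : Type*) [AddCommGroup M] [Module (LaurentRing d) M]
    (n : Fin d → ℤ) : DiscreteDual M → DiscreteDual M :=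
  DiscreteDual.dualMap (DistribSMul.toAddMonoidHom M (laurentMonomial n))

/-- `α_M` is an action of `ℤ^d`: the zero vector acts trivially. -/
theorem algebraicAction_zero {d : ℕ} (M : Type*) [AddCommGroup M] [Module (LaurentRing d) M] :
    algebraicAction (d := d) M 0 = id := by
  funext x
  apply PontryaginDual.ext
  intro m
  change x (Multiplicative.ofAdd
    (laurentMonomial (0 : Fin d → ℤ) • (Multiplicative.toAdd m : M)) : Multiplicative M) = x m
  have h : laurentMonomial (0 : Fin d → ℤ) = 1 := rfl
  rw [h, one_smul]
  rfl

/-- `α_M` is an action of `ℤ^d`: `α_M^{a+b} = α_M^a ∘ α_M^b`. -/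
theorem algebraicAction_add {d : ℕ} (M : Type*) [AddCommGroup M] [Module (LaurentRing d) M]
    (a b : Fin d → ℤ) :
    algebraicAction M (a + b) = algebraicAction M a ∘ algebraicAction M b := by
  funext x
  apply PontryaginDual.ext
  intro m
  change x (Multiplicative.ofAdd
      (laurentMonomial (a + b) • (Multiplicative.toAdd m : M)) : Multiplicative M) =
    x (Multiplicative.ofAdd
      (laurentMonomial b • laurentMonomial a • (Multiplicative.toAdd m : M)) : Multiplicative M)
  have h : laurentMonomial (a + b) = laurentMonomial b * laurentMonomial a := by
    simp [laurentMonomial, AddMonoidAlgebra.single_mul_single, add_comm]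
  rw [h, mul_smul]

/-- `α_M` acts by measure-preserving maps. -/
theorem measurePreserving_algebraicAction {d : ℕ} (M : Type*) [AddCommGroup M]
    [Module (LaurentRing d) M] (a : Fin d → ℤ) :
    MeasurePreserving (algebraicAction M a) (DiscreteDual.haar M) (DiscreteDual.haar M) := by
  have hs : Function.Surjective (algebraicAction M a) := fun x =>
    ⟨algebraicAction M (-a) x, by
      have h := congrFun (algebraicAction_add M a (-a)) x
      rw [add_neg_cancel, algebraicAction_zero] at h
      exact h.symm⟩
  unfold DiscreteDual.haar
  exact MonoidHom.measurePreserving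
    (f := (DiscreteDual.dualMap
      (DistribSMul.toAddMonoidHom M (laurentMonomial a))).toMonoidHom)
    (ContinuousMonoidHom.continuous_toFun _) hs rfl

/-- The ideal `⟨2, 1 + u₁ + u₂ + u₂²⟩` of `R_2`. -/
def exampleIdeal : Ideal (LaurentRing 2) :=
  Ideal.span {2, 1 + laurentVar 0 + laurentVar 1 + laurentVar 1 ^ 2}

end

noncomputable section

/-! ### Sums of three monomials in `t` and `1 + t + t²` over `𝔽₂` -/

namespace Ledrappier

open Polynomial

/-! In characteristic 2 the relation reads `u₁ = 1 + t + t²` with `t = u₂`, so the module is `𝔽₂[t]`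
with `t` and `quad = 1 + t + t²` inverted, and monomials in `u₁, u₂` become products of powers of
`quad` and `t`.

Order 3 holds. Expanding indicators in characters, mixing along a sequence follows once no nonzero
`m` satisfies `∑ u^{n_s} m_s = 0` for infinitely many indices
(`isMixingAlong_of_eventually_sum_ne_zero`). Denominators clear, so the coefficients may be taken in
`𝔽₂[t]`. If a coefficient vanishes, at most two terms remain and the exponent difference would be
constant. Otherwise a descent applies: powers of `t` and `quad` are moved from the coefficients to
the exponents, and the exponents are halved along an ultrafilter. The relation then splits as `P² +
tQ² = 0`, so `P = Q = 0`. Eliminating one term shows that these two relations are proportional,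
which gives a relation whose coefficients `r_s` satisfy `r_s² ∣ m_s` (`descent`). Degrees drop until
all coefficients are 1, and evaluation at `t = 1` gives `1 + 1 + 1 = 0` in `𝔽₂`, which is false
(`false_of_ne_zero`).

Order above 3 fails: by Frobenius, the four-term relation persists with all exponents multiplied by
`2^j`, so three of four `±1`-valued characters determine the fourth (`not_mixingOfOrder`). -/

/-- The polynomial `1 + t + t²` over `𝔽₂`. -/
def quad : (ZMod 2)[X] := 1 + X + X ^ 2

/-- The product `t^a (1 + t + t²)^b`, where `k = (a, b)`. -/
def mono (k : ℕ × ℕ) : (ZMod 2)[X] := X ^ k.1 * quad ^ k.2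

theorem quad_natDegree : quad.natDegree = 2 := by
  unfold quad; compute_degree!

theorem quad_ne_zero : quad ≠ 0 := by
  intro h
  have := quad_natDegree
  simp [h] at this

theorem quad_eval (a : ZMod 2) : quad.eval a = 1 := by
  revert a
  simp only [quad, eval_add, eval_one, eval_X, eval_pow]
  decide

theorem quad_irreducible : Irreducible quad :=
  irreducible_of_degree_le_three_of_not_isRoot (by simp [quad_natDegree])
    (fun a h => by simp [IsRoot, quad_eval] at h)

theorem mono_add (k l : ℕ × ℕ) : mono (k + l) = mono k * mono l := by
  simp only [mono, Prod.fst_add, Prod.snd_add, pow_add]; ring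

theorem mono_ne_zero (k : ℕ × ℕ) : mono k ≠ 0 :=
  mul_ne_zero (pow_ne_zero _ X_ne_zero) (pow_ne_zero _ quad_ne_zero)

theorem mono_eval_one (k : ℕ × ℕ) : (mono k).eval 1 = 1 := by
  simp [mono, quad_eval]

theorem not_X_dvd_quad : ¬ (X : (ZMod 2)[X]) ∣ quad := by
  rw [X_dvd_iff, coeff_zero_eq_eval_zero, quad_eval]; exact one_ne_zero

theorem not_quad_dvd_X : ¬ quad ∣ (X : (ZMod 2)[X]) := by
  intro h
  have := natDegree_le_of_dvd h X_ne_zero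
  rw [quad_natDegree, natDegree_X] at this
  omega

/-- Cancelling the smaller power of `t` and evaluating at 0, where `quad` is 1, rules out a surplus
factor `t`. -/
theorem mono_fst_le {k l : ℕ × ℕ} (h : mono k = mono l) : k.1 ≤ l.1 := by
  by_contra! hlt
  obtain ⟨c, hc⟩ := Nat.exists_eq_add_of_lt hlt
  have h' : X ^ (c + 1) * quad ^ k.2 = quad ^ l.2 := by
    apply mul_left_cancel₀ (pow_ne_zero l.1 (X_ne_zero (R := ZMod 2)))
    rw [← mul_assoc, ← pow_add, ← add_assoc, ← hc]
    exact h
  have h2 := congrArg (eval 0) h'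
  simp [quad_eval] at h2

theorem mono_injective : Function.Injective mono := by
  intro k l h
  have h1 : k.1 = l.1 := le_antisymm (mono_fst_le h) (mono_fst_le h.symm)
  have h2 : quad ^ k.2 = quad ^ l.2 := by
    apply mul_left_cancel₀ (pow_ne_zero k.1 (X_ne_zero (R := ZMod 2)))
    have h' := h
    simp only [mono] at h'
    rw [h', h1]
  have h3 := congrArg natDegree h2
  rw [natDegree_pow, natDegree_pow, quad_natDegree] at h3
  exact Prod.ext h1 (by omega)

/-! ### Relations with fixed coefficients between separating monomials -/

/-- Two families of exponents move apart along a filter: their difference leaves every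
finite set. -/
def Apart {ι : Type*} (U : Filter ι) (a b : ι → ℕ × ℕ) : Prop :=
  ∀ k l : ℕ × ℕ, ∀ᶠ j in U, a j + k ≠ b j + l

/-- A two-term relation fixes the ratio `mono (a j) / mono (b j)`. Comparing two indices,
injectivity of `mono` makes the exponent difference constant, against `Apart`. -/
theorem left_eq_zero_of_pair {ι : Type*} {U : Filter ι} [U.NeBot] {a b : ι → ℕ × ℕ}
    (hab : Apart U a b) {c d : (ZMod 2)[X]}
    (h : ∀ᶠ j in U, c * mono (a j) + d * mono (b j) = 0) : c = 0 := by
  by_contra hc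
  obtain ⟨i, hi⟩ := h.exists
  have hd : d ≠ 0 := by
    rintro rfl
    simp [hc, mono_ne_zero] at hi
  obtain ⟨j, hj, hj'⟩ := (h.and (hab (b i) (a i))).exists
  apply hj'
  apply mono_injective
  rw [mono_add, mono_add]
  apply mul_left_cancel₀ (mul_ne_zero hc hd)
  linear_combination d * mono (b i) * hj - d * mono (b j) * hi

theorem eq_zero_of_coeff_eq_zero {ι : Type*} {U : Filter ι} [U.NeBot]
    {n : ι → Fin 3 → ℕ × ℕ} (hn : ∀ s t, s ≠ t → Apart U (fun j => n j s) (fun j => n j t))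
    {g : Fin 3 → (ZMod 2)[X]} (h : ∀ᶠ j in U, ∑ s, g s * mono (n j s) = 0)
    (s : Fin 3) (hs : g s = 0) : g = 0 := by
  have key : ∀ a b : Fin 3, a ≠ b →
      (∀ j, ∑ s, g s * mono (n j s) = g a * mono (n j a) + g b * mono (n j b)) →
      g a = 0 ∧ g b = 0 := by
    intro a b hab hsum
    refine ⟨left_eq_zero_of_pair (hn a b hab) (h.mono fun j hj => (hsum j).symm.trans hj),
      left_eq_zero_of_pair (d := g a) (hn b a hab.symm) (h.mono fun j hj => ?_)⟩
    rw [add_comm]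
    exact (hsum j).symm.trans hj
  funext i
  fin_cases s
  · have := key 1 2 (by decide) (fun j => by simp at hs; simp [Fin.sum_univ_three, hs])
    fin_cases i <;> simp_all
  · have := key 0 2 (by decide) (fun j => by simp at hs; simp [Fin.sum_univ_three, hs])
    fin_cases i <;> simp_all
  · have := key 0 1 (by decide) (fun j => by simp at hs; simp [Fin.sum_univ_three, hs])
    fin_cases i <;> simp_all

theorem exists_sq_add_X_mul_sq (c : (ZMod 2)[X]) : ∃ p q : (ZMod 2)[X], c = p ^ 2 + X * q ^ 2 := by
  induction c using Polynomial.induction_on' with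
  | add a b ha hb =>
    obtain ⟨p, q, rfl⟩ := ha
    obtain ⟨p', q', rfl⟩ := hb
    exact ⟨p + p', q + q', by rw [CharTwo.add_sq, CharTwo.add_sq]; ring⟩
  | monomial n a =>
    -- Squaring fixes `𝔽₂`, so a monomial of even degree is a square and one of odd degree is `t`
    -- times a square.
    have ha : a ^ 2 = a := ZMod.pow_card a
    rcases Nat.even_or_odd' n with ⟨k, rfl | rfl⟩
    · refine ⟨monomial k a, 0, ?_⟩
      simp [monomial_pow, ha, mul_comm]
    · refine ⟨0, monomial k a, ?_⟩
      simp [monomial_pow, ha, X_mul_monomial, mul_comm]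

/-- In characteristic 2 the derivative of `p² + t q²` is `q²`. -/
theorem eq_zero_of_sq_add_X_mul_sq {p q : (ZMod 2)[X]} (h : p ^ 2 + X * q ^ 2 = 0) :
    p = 0 ∧ q = 0 := by
  have hq : q = 0 := by
    have h' := congrArg derivative h
    simp only [derivative_add, derivative_mul, derivative_sq, derivative_X,
      CharTwo.two_eq_zero, map_zero, zero_mul, mul_zero, one_mul, add_zero, zero_add] at h'
    exact pow_eq_zero_iff two_ne_zero |>.1 h'
  subst hq
  exact ⟨by simpa using h, rfl⟩

/-- `𝔽₂[t]` is a principal ideal domain: `a` is the gcd of the entries, and dividing Bézout's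
identity by it gives the last clause. -/
theorem exists_primitive {p : Fin 3 → (ZMod 2)[X]} (hp : p ≠ 0) :
    ∃ (a : (ZMod 2)[X]) (r u : Fin 3 → (ZMod 2)[X]), a ≠ 0 ∧ (∀ i, p i = a * r i) ∧
      ∑ i, u i * r i = 1 := by
  obtain ⟨a, ha⟩ := (IsPrincipalIdealRing.principal (Ideal.span (Set.range p))).principal
  have hmem : ∀ i, p i ∈ Ideal.span {a} := fun i => by
    rw [← Ideal.submodule_span_eq, ← ha]
    exact Ideal.subset_span ⟨i, rfl⟩
  have ha0 : a ≠ 0 := by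
    rintro rfl
    exact hp (funext fun i => by simpa using hmem i)
  choose r hr using fun i => Ideal.mem_span_singleton.1 (hmem i)
  have haa : a ∈ Ideal.span (Set.range p) := by
    rw [ha]; exact Submodule.mem_span_singleton_self a
  obtain ⟨u, hu⟩ := Ideal.mem_span_range_iff_exists_fun.1 haa
  refine ⟨a, r, u, ha0, hr, mul_left_cancel₀ ha0 ?_⟩
  rw [mul_one, Finset.mul_sum]
  conv_rhs => rw [← hu]
  exact Finset.sum_congr rfl fun i _ => by rw [hr i]; ring

/-- Two proportional vectors of polynomials are multiples of one vector. -/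
theorem exists_common_direction {p q : Fin 3 → (ZMod 2)[X]} (h : p ≠ 0 ∨ q ≠ 0)
    (hpq : ∀ i j, p i * q j = q i * p j) :
    ∃ (a b : (ZMod 2)[X]) (r : Fin 3 → (ZMod 2)[X]), (a ≠ 0 ∨ b ≠ 0) ∧
      (∀ i, p i = a * r i) ∧ ∀ i, q i = b * r i := by
  have key : ∀ p q : Fin 3 → (ZMod 2)[X], p ≠ 0 → (∀ i j, p i * q j = q i * p j) →
      ∃ (a b : (ZMod 2)[X]) (r : Fin 3 → (ZMod 2)[X]), a ≠ 0 ∧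
      (∀ i, p i = a * r i) ∧ ∀ i, q i = b * r i := by
    intro p q hp hpq
    obtain ⟨a, r, u, ha, hr, hu⟩ := exists_primitive hp
    refine ⟨a, ∑ i, u i * q i, r, ha, hr, fun j => ?_⟩
    have h2 : ∀ i, r i * q j = q i * r j := fun i => by
      apply mul_left_cancel₀ ha
      rw [← mul_assoc, ← hr, hpq, hr j]; ring
    calc q j = (∑ i, u i * r i) * q j := by rw [hu, one_mul]
      _ = (∑ i, u i * q i) * r j := by
        rw [Finset.sum_mul, Finset.sum_mul]
        exact Finset.sum_congr rfl fun i _ => by rw [mul_assoc, h2, mul_assoc]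
  rcases h with h | h
  · obtain ⟨a, b, r, ha, h1, h2⟩ := key p q h hpq
    exact ⟨a, b, r, Or.inl ha, h1, h2⟩
  · obtain ⟨a, b, r, ha, h1, h2⟩ := key q p h fun i j => (hpq i j).symm
    exact ⟨b, a, r, Or.inr ha, h2, h1⟩

theorem exists_eq_mono_mul {m : (ZMod 2)[X]} (hm : m ≠ 0) :
    ∃ (k : ℕ × ℕ) (m' : (ZMod 2)[X]), m = mono k * m' ∧ ¬ X ∣ m' ∧ ¬ quad ∣ m' := by
  obtain ⟨a, m₁, h₁, rfl⟩ := WfDvdMonoid.max_power_factor hm (irreducible_X (R := ZMod 2))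
  have hm₁ : m₁ ≠ 0 := by rintro rfl; simp at hm
  obtain ⟨b, m₂, h₂, rfl⟩ := WfDvdMonoid.max_power_factor hm₁ quad_irreducible
  exact ⟨(a, b), m₂, by simp only [mono]; ring, fun h => h₁ (h.mul_left _), h₂⟩

/-- The exponents in `e` are at most 1, so a factor `X` or `quad` of `r`, squared, would leave a
copy dividing `m`. Hence `r` is coprime to `mono e`. -/
theorem sq_dvd_of_sq_dvd_mul_mono {m r : (ZMod 2)[X]} {e : ℕ × ℕ} (hX : ¬ X ∣ m)
    (hq : ¬ quad ∣ m) (he : e.1 ≤ 1 ∧ e.2 ≤ 1) (h : r ^ 2 ∣ m * mono e) : r ^ 2 ∣ m := by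
  have hXr : ¬ X ∣ r := by
    intro hr
    have h1 : X * X ∣ X * (m * quad ^ e.2) := by
      rw [← sq]
      refine ((pow_dvd_pow_of_dvd hr 2).trans h).trans ?_
      have : X * (m * quad ^ e.2) = m * (X ^ 1 * quad ^ e.2) := by ring
      rw [this]
      exact mul_dvd_mul_left _ (mul_dvd_mul_right (pow_dvd_pow _ he.1) _)
    have h2 := (mul_dvd_mul_iff_left X_ne_zero).1 h1
    rcases prime_X.dvd_or_dvd h2 with h3 | h3
    · exact hX h3
    · exact not_X_dvd_quad (prime_X.dvd_of_dvd_pow h3)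
  have hqr : ¬ quad ∣ r := by
    intro hr
    have h1 : quad * quad ∣ quad * (m * X ^ e.1) := by
      rw [← sq]
      refine ((pow_dvd_pow_of_dvd hr 2).trans h).trans ?_
      have : quad * (m * X ^ e.1) = m * (X ^ e.1 * quad ^ 1) := by ring
      rw [this]
      exact mul_dvd_mul_left _ (mul_dvd_mul_left _ (pow_dvd_pow _ he.2))
    have h2 := (mul_dvd_mul_iff_left quad_ne_zero).1 h1
    rcases quad_irreducible.prime.dvd_or_dvd h2 with h3 | h3
    · exact hq h3
    · exact not_quad_dvd_X (quad_irreducible.prime.dvd_of_dvd_pow h3)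
  have hc : IsCoprime (r ^ 2) (mono e) :=
    IsCoprime.mul_right ((irreducible_X.coprime_iff_not_dvd.2 hXr).symm.pow)
      ((quad_irreducible.coprime_iff_not_dvd.2 hqr).symm.pow)
  exact hc.dvd_of_dvd_mul_right h

/-- Halving exponents of constant parity along an ultrafilter. -/
theorem exists_halves {ι : Type*} (U : Ultrafilter ι) (n : ι → Fin 3 → ℕ × ℕ) :
    ∃ (w : ι → Fin 3 → ℕ × ℕ) (e : Fin 3 → ℕ × ℕ), (∀ s, (e s).1 ≤ 1 ∧ (e s).2 ≤ 1) ∧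
      ∀ᶠ j in (U : Filter ι), ∀ s, n j s = w j s + w j s + e s := by
  let par : ι → Fin 3 → Fin 2 × Fin 2 := fun j s =>
    (⟨(n j s).1 % 2, Nat.mod_lt _ two_pos⟩, ⟨(n j s).2 % 2, Nat.mod_lt _ two_pos⟩)
  -- Parity patterns form a finite type, on which every ultrafilter is principal: one pattern holds
  -- eventually.
  obtain ⟨e, he⟩ := (U.map par).eq_pure_of_finite
  have he' : ∀ᶠ j in (U : Filter ι), par j = e := by
    have h1 : {e} ∈ U.map par := by rw [he]; exact rfl
    exact h1
  refine ⟨fun j s => ((n j s).1 / 2, (n j s).2 / 2), fun s => ((e s).1, (e s).2),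
    fun s => ⟨by have := (e s).1.2; simp only; omega, by have := (e s).2.2; simp only; omega⟩,
    he'.mono fun j hj s => ?_⟩
  subst hj
  ext <;> simp [par] <;> omega

/-- The square root of a three-term relation: halved exponents, and coefficients whose squares
divide the old ones. -/
theorem descent {ι : Type*} (U : Ultrafilter ι) {n : ι → Fin 3 → ℕ × ℕ}
    (hn : ∀ s t, s ≠ t → Apart (U : Filter ι) (fun j => n j s) (fun j => n j t))
    {m : Fin 3 → (ZMod 2)[X]} (hX : ∀ s, ¬ X ∣ m s) (hq : ∀ s, ¬ quad ∣ m s)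
    (h : ∀ᶠ j in (U : Filter ι), ∑ s, m s * mono (n j s) = 0) :
    ∃ (w : ι → Fin 3 → ℕ × ℕ) (r : Fin 3 → (ZMod 2)[X]),
      (∀ s t, s ≠ t → Apart (U : Filter ι) (fun j => w j s) (fun j => w j t)) ∧
      (∀ s, r s ^ 2 ∣ m s) ∧ ∀ᶠ j in (U : Filter ι), ∑ s, r s * mono (w j s) = 0 := by
  obtain ⟨w, e, he, hw⟩ := exists_halves U n
  have hwa : ∀ s t, s ≠ t → Apart (U : Filter ι) (fun j => w j s) (fun j => w j t) := by
    intro s t hst k l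
    filter_upwards [hn s t hst (k + k + e t) (l + l + e s), hw] with j hj hwj hkl
    apply hj
    rw [hwj s, hwj t]
    calc w j s + w j s + e s + (k + k + e t) = (w j s + k) + (w j s + k) + e s + e t := by abel
      _ = _ := by rw [hkl]; abel
  choose p q hpq using fun s => exists_sq_add_X_mul_sq (m s * mono (e s))
  have hz : ∀ᶠ j in (U : Filter ι),
      ∑ s, p s * mono (w j s) = 0 ∧ ∑ s, q s * mono (w j s) = 0 := by
    filter_upwards [h, hw] with j hj hwj
    apply eq_zero_of_sq_add_X_mul_sq
    rw [CharTwo.sum_sq, CharTwo.sum_sq, Finset.mul_sum, ← Finset.sum_add_distrib, ← hj]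
    refine Finset.sum_congr rfl fun s _ => ?_
    rw [hwj s, mono_add, mono_add]
    linear_combination (-mono (w j s) ^ 2) * hpq s
  have hprop : ∀ i j, p i * q j = q i * p j := by
    intro i t
    -- This combination of the two relations kills the coefficient at index `t`, so the two-term
    -- case forces the others to vanish too.
    have h0 : (fun i => p i * q t - q i * p t) = 0 := by
      refine eq_zero_of_coeff_eq_zero hwa (hz.mono fun j hj => ?_) t (by ring)
      calc ∑ s, (p s * q t - q s * p t) * mono (w j s)
          = q t * ∑ s, p s * mono (w j s) - p t * ∑ s, q s * mono (w j s) := by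
            rw [Finset.mul_sum, Finset.mul_sum, ← Finset.sum_sub_distrib]
            exact Finset.sum_congr rfl fun s _ => by ring
        _ = 0 := by rw [hj.1, hj.2]; ring
    exact sub_eq_zero.1 (congrFun h0 i)
  have hne : p ≠ 0 ∨ q ≠ 0 := by
    by_contra! hcon
    have h0 := hpq 0
    rw [hcon.1, hcon.2] at h0
    simp [mono_ne_zero] at h0
    exact hX 0 (h0 ▸ dvd_zero _)
  obtain ⟨a, b, r, hab, hpa, hqb⟩ := exists_common_direction hne hprop
  refine ⟨w, r, hwa, fun s => sq_dvd_of_sq_dvd_mul_mono (hX s) (hq s) (he s)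
    ⟨a ^ 2 + X * b ^ 2, by rw [hpq s, hpa s, hqb s]; ring⟩, hz.mono fun j hj => ?_⟩
  have hfac : ∀ (c : (ZMod 2)[X]) (v : Fin 3 → (ZMod 2)[X]), (∀ i, v i = c * r i) → c ≠ 0 →
      ∑ s, v s * mono (w j s) = 0 → ∑ s, r s * mono (w j s) = 0 := by
    intro c v hv hc h0
    apply (mul_eq_zero.1 _).resolve_left hc
    rw [← h0, Finset.mul_sum]
    exact Finset.sum_congr rfl fun s _ => by rw [hv s]; ring
  rcases hab with ha | hb
  · exact hfac a p hpa ha hj.1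
  · exact hfac b q hqb hb hj.2

/-- Induction on the total degree of the coefficients, which `descent` at least halves after
stripping. It stops only when all stripped coefficients equal 1, and then the odd number of terms
gives a contradiction at `t = 1`. -/
theorem false_of_ne_zero {ι : Type*} (U : Ultrafilter ι) (N : ℕ) :
    ∀ {n : ι → Fin 3 → ℕ × ℕ}
    (_ : ∀ s t, s ≠ t → Apart (U : Filter ι) (fun j => n j s) (fun j => n j t))
    {m : Fin 3 → (ZMod 2)[X]} (_ : ∀ s, m s ≠ 0) (_ : ∑ s, (m s).natDegree = N)
    (_ : ∀ᶠ j in (U : Filter ι), ∑ s, m s * mono (n j s) = 0), False := by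
  induction N using Nat.strong_induction_on with
  | _ N ih =>
    intro n hn m hm hN h
    choose k m' hmk hX hq using fun s => exists_eq_mono_mul (hm s)
    have hm' : ∀ s, m' s ≠ 0 := fun s h0 => hX s (h0 ▸ dvd_zero _)
    have hdeg : ∀ s, (m' s).natDegree ≤ (m s).natDegree := fun s =>
      natDegree_le_of_dvd ⟨mono (k s), by rw [hmk s, mul_comm]⟩ (hm s)
    have hn' : ∀ s t, s ≠ t →
        Apart (U : Filter ι) (fun j => n j s + k s) (fun j => n j t + k t) := by
      intro s t hst a b
      filter_upwards [hn s t hst (k s + a) (k t + b)] with j hj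
      simpa only [add_assoc] using hj
    have h' : ∀ᶠ j in (U : Filter ι), ∑ s, m' s * mono (n j s + k s) = 0 := by
      filter_upwards [h] with j hj
      rw [← hj]
      refine Finset.sum_congr rfl fun s _ => ?_
      rw [mono_add]
      linear_combination (-mono (n j s)) * hmk s
    obtain ⟨w, r, hw, hr, hs⟩ := descent U (n := fun j s => n j s + k s) hn' hX hq h'
    have hr0 : ∀ s, r s ≠ 0 := by
      intro s h0
      have := hr s
      rw [h0] at this
      exact hm' s (by simpa using this)
    have hrdeg : ∀ s, 2 * (r s).natDegree ≤ (m' s).natDegree := fun s => by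
      rw [← natDegree_pow]
      exact natDegree_le_of_dvd (hr s) (hm' s)
    by_cases hz : ∀ s, (m' s).natDegree = 0
    · obtain ⟨j, hj⟩ := h'.exists
      have h1 : ∀ s, m' s = 1 := by
        intro s
        obtain ⟨a, ha⟩ := natDegree_eq_zero.1 (hz s)
        have ha0 : a ≠ 0 := by
          rintro rfl
          exact hm' s (by rw [← ha, map_zero])
        have ha1 : a = 1 := Fin.eq_one_of_ne_zero a ha0
        rw [← ha, ha1, map_one]
      have h2 := congrArg (eval 1) hj
      simp [h1, mono_eval_one, eval_finsetSum] at h2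
      exact absurd h2 (by decide)
    · push Not at hz
      obtain ⟨s, hs0⟩ := hz
      refine ih (∑ s, (r s).natDegree) ?_ hw hr0 rfl hs
      rw [← hN]
      refine Finset.sum_lt_sum (fun i _ => ?_) ⟨s, Finset.mem_univ s, ?_⟩
      · have := hrdeg i; have := hdeg i; omega
      · have := hrdeg s; have := hdeg s; omega

/-- A linear relation with constant coefficients between three monomials in `t` and
`1 + t + t²` that move apart is trivial. -/
theorem eq_zero_of_sum_mono_eq_zero {ι : Type*} (U : Ultrafilter ι) {n : ι → Fin 3 → ℕ × ℕ}
    (hn : ∀ s t, s ≠ t → Apart (U : Filter ι) (fun j => n j s) (fun j => n j t))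
    {g : Fin 3 → (ZMod 2)[X]} (h : ∀ᶠ j in (U : Filter ι), ∑ s, g s * mono (n j s) = 0) :
    g = 0 := by
  by_cases hg : ∃ s, g s = 0
  · obtain ⟨s, hs⟩ := hg
    exact eq_zero_of_coeff_eq_zero hn h s hs
  · push Not at hg
    exact (false_of_ne_zero U _ hn hg rfl h).elim

end Ledrappier
end

noncomputable section

/-! ### The ring `R₂ / ⟨2, 1 + u₁ + u₂ + u₂²⟩` -/

namespace Ledrappier

open Polynomial

theorem laurentMonomial_add {d : ℕ} (a b : Fin d → ℤ) :
    laurentMonomial (a + b) = laurentMonomial a * laurentMonomial b := by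
  simp [laurentMonomial, AddMonoidAlgebra.single_mul_single]

theorem laurentMonomial_zero {d : ℕ} : laurentMonomial (0 : Fin d → ℤ) = 1 := rfl

theorem laurentMonomial_nsmul {d : ℕ} (k : ℕ) (a : Fin d → ℤ) :
    laurentMonomial (k • a) = laurentMonomial a ^ k := by
  simp [laurentMonomial, AddMonoidAlgebra.single_pow]

/-- The quotient ring `R₂ / ⟨2, 1 + u₁ + u₂ + u₂²⟩`. -/
abbrev ExampleRing : Type := LaurentRing 2 ⧸ exampleIdeal

/-- The image of the monomial `u^n` in the quotient ring. -/
def unitMono (n : Fin 2 → ℤ) : ExampleRing := Ideal.Quotient.mk exampleIdeal (laurentMonomial n)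

theorem unitMono_add (a b : Fin 2 → ℤ) : unitMono (a + b) = unitMono a * unitMono b := by
  simp [unitMono, laurentMonomial_add]

theorem unitMono_zero : unitMono 0 = 1 := by
  simp [unitMono, laurentMonomial_zero]

theorem unitMono_nsmul (k : ℕ) (a : Fin 2 → ℤ) : unitMono (k • a) = unitMono a ^ k := by
  rw [unitMono, laurentMonomial_nsmul, map_pow]; rfl

theorem isUnit_unitMono (n : Fin 2 → ℤ) : IsUnit (unitMono n) :=
  IsUnit.of_mul_eq_one (unitMono (-n)) (by rw [← unitMono_add, add_neg_cancel, unitMono_zero])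

theorem smul_eq_unitMono_mul (n : Fin 2 → ℤ) (m : ExampleRing) :
    laurentMonomial n • m = unitMono n * m := by
  obtain ⟨x, rfl⟩ := Ideal.Quotient.mk_surjective m
  rfl

theorem exampleRing_two : (2 : ExampleRing) = 0 := by
  have : Ideal.Quotient.mk exampleIdeal 2 = 0 :=
    Ideal.Quotient.eq_zero_iff_mem.2 (Ideal.subset_span (by simp))
  exact (map_ofNat (Ideal.Quotient.mk exampleIdeal) 2).symm.trans this

theorem exampleRing_relation :
    1 + unitMono (Pi.single 0 1) + unitMono (Pi.single 1 1) + unitMono (Pi.single 1 1) ^ 2 = 0 := by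
  have : Ideal.Quotient.mk exampleIdeal
      (1 + laurentVar 0 + laurentVar 1 + laurentVar 1 ^ 2) = 0 :=
    Ideal.Quotient.eq_zero_iff_mem.2 (Ideal.subset_span (by simp))
  simpa [unitMono, laurentVar] using this

/-- The multiplicative map `u^n ↦ (1 + t + t²)^{n₁} t^{n₂}` to the field of rational functions. -/
def monoFrac : Multiplicative (Fin 2 → ℤ) →* FractionRing (ZMod 2)[X] where
  toFun n := algebraMap _ _ quad ^ (n.toAdd 0) * algebraMap _ _ (X : (ZMod 2)[X]) ^ (n.toAdd 1)
  map_one' := by simp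
  map_mul' a b := by
    have h1 : algebraMap (ZMod 2)[X] (FractionRing (ZMod 2)[X]) quad ≠ 0 := by
      simpa using quad_ne_zero
    have h2 : algebraMap (ZMod 2)[X] (FractionRing (ZMod 2)[X]) X ≠ 0 := by
      simp
    simp only [toAdd_mul, Pi.add_apply, zpow_add₀ h1, zpow_add₀ h2]
    ring

/-- The evaluation of Laurent polynomials at `u₁ = 1 + t + t²`, `u₂ = t`. -/
def laurentToFrac : LaurentRing 2 →+* FractionRing (ZMod 2)[X] :=
  (AddMonoidAlgebra.lift ℤ (FractionRing (ZMod 2)[X]) (Fin 2 → ℤ) monoFrac).toRingHom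

theorem laurentToFrac_monomial (n : Fin 2 → ℤ) :
    laurentToFrac (laurentMonomial n) =
      algebraMap _ _ quad ^ n 0 * algebraMap _ _ (X : (ZMod 2)[X]) ^ n 1 := by
  simp [laurentToFrac, laurentMonomial, monoFrac]

theorem frac_two : (2 : FractionRing (ZMod 2)[X]) = 0 := by
  have h : (2 : (ZMod 2)[X]) = 0 := CharTwo.two_eq_zero
  have h' := congrArg (algebraMap (ZMod 2)[X] (FractionRing (ZMod 2)[X])) h
  rwa [map_ofNat, map_zero] at h'

/-- The embedding of the quotient ring into the field of rational functions. -/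
def toFrac : ExampleRing →+* FractionRing (ZMod 2)[X] :=
  Ideal.Quotient.lift exampleIdeal laurentToFrac (by
    intro a ha
    rw [← RingHom.mem_ker]
    refine (Ideal.span_le (I := RingHom.ker laurentToFrac)).2 ?_ ha
    rintro x (rfl | rfl)
    · exact (map_ofNat laurentToFrac 2).trans frac_two
    · have h : (1 + quad + X + X ^ 2 : (ZMod 2)[X]) = 0 := by
        have : (2 : (ZMod 2)[X]) = 0 := CharTwo.two_eq_zero
        rw [quad]
        linear_combination (1 + X + X ^ 2) * this
      have h' := congrArg (algebraMap (ZMod 2)[X] (FractionRing (ZMod 2)[X])) h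
      simpa [RingHom.mem_ker, laurentVar, laurentToFrac_monomial] using h')

theorem toFrac_unitMono (n : Fin 2 → ℤ) : toFrac (unitMono n) =
    algebraMap _ _ quad ^ n 0 * algebraMap _ _ (X : (ZMod 2)[X]) ^ n 1 := by
  rw [unitMono, toFrac, Ideal.Quotient.lift_mk, laurentToFrac_monomial]

instance : Nontrivial ExampleRing := toFrac.domain_nontrivial

instance : CharP ExampleRing 2 := CharTwo.of_one_ne_zero_of_two_eq_zero one_ne_zero exampleRing_two

/-- The inclusion of `𝔽₂[t]` in the quotient ring, with `t = u₂`. -/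
def ofPoly : (ZMod 2)[X] →+* ExampleRing :=
  eval₂RingHom (ZMod.castHom (dvd_refl 2) ExampleRing) (unitMono (Pi.single 1 1))

theorem ofPoly_X : ofPoly X = unitMono (Pi.single 1 1) := by simp [ofPoly]

theorem ofPoly_quad : ofPoly quad = unitMono (Pi.single 0 1) := by
  rw [quad, map_add, map_add, map_one, map_pow, ofPoly_X]
  linear_combination exampleRing_relation - unitMono (Pi.single 0 1) * exampleRing_two

/-- The exponents `(n₁, n₂)` in `ℤ²` of the monomial `t^{n₂} (1 + t + t²)^{n₁}`. -/
def toExp (k : ℕ × ℕ) : Fin 2 → ℤ := ![(k.2 : ℤ), (k.1 : ℤ)]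

theorem toExp_add (k l : ℕ × ℕ) : toExp (k + l) = toExp k + toExp l := by
  ext i; fin_cases i <;> simp [toExp]

theorem ofPoly_mono (k : ℕ × ℕ) : ofPoly (mono k) = unitMono (toExp k) := by
  rw [mono, map_mul, map_pow, map_pow, ofPoly_X, ofPoly_quad, ← unitMono_nsmul, ← unitMono_nsmul,
    ← unitMono_add]
  congr 1
  ext i; fin_cases i <;> simp [toExp]

theorem toFrac_comp_ofPoly : toFrac.comp ofPoly = algebraMap _ (FractionRing (ZMod 2)[X]) := by
  apply Polynomial.ringHom_ext'
  · exact Subsingleton.elim _ _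
  · simp [ofPoly_X, toFrac_unitMono]

/-- Evaluation in the field of rational functions splits off the inclusion of `𝔽₂[t]`, so primality
of the ideal is never needed. -/
theorem ofPoly_injective : Function.Injective ofPoly := by
  have h : Function.Injective (toFrac.comp ofPoly) := by
    rw [toFrac_comp_ofPoly]
    exact IsFractionRing.injective _ _
  exact Function.Injective.of_comp h

/-- The positive part of a vector, in the order used by `toExp`. -/
def posPart (n : Fin 2 → ℤ) : ℕ × ℕ := ((n 1).toNat, (n 0).toNat)

theorem toExp_posPart (n : Fin 2 → ℤ) : toExp (posPart n) = n + toExp (posPart (-n)) := by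
  ext i; fin_cases i <;> simp [toExp, posPart] <;> omega

theorem toExp_posPart_of_nonneg {n : Fin 2 → ℤ} (h : ∀ i, 0 ≤ n i) : toExp (posPart n) = n := by
  ext i; fin_cases i <;> simp [toExp, posPart, h]

theorem exists_ofPoly_eq (m : ExampleRing) :
    ∃ (k : ℕ × ℕ) (g : (ZMod 2)[X]), unitMono (toExp k) * m = ofPoly g := by
  obtain ⟨x, rfl⟩ := Ideal.Quotient.mk_surjective m
  induction x using AddMonoidAlgebra.induction_linear with
  | zero => exact ⟨0, 0, by simp⟩
  | add a b ha hb =>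
    obtain ⟨k, g, hk⟩ := ha
    obtain ⟨l, g', hl⟩ := hb
    refine ⟨k + l, mono l * g + mono k * g', ?_⟩
    rw [toExp_add, unitMono_add, map_add, map_add, map_mul, map_mul, ofPoly_mono, ofPoly_mono,
      ← hk, ← hl]
    ring
  | single n c =>
    refine ⟨posPart (-n), c * mono (posPart n), ?_⟩
    have h : (AddMonoidAlgebra.single n c : LaurentRing 2) = c * laurentMonomial n := by
      rw [← zsmul_eq_mul, laurentMonomial, AddMonoidAlgebra.smul_single]; simp
    rw [h, map_mul, map_mul, map_intCast, map_intCast, ofPoly_mono, toExp_posPart n, unitMono_add]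
    change _ * (_ * unitMono n) = _
    ring

/-- Along a sequence of triples that moves apart there is no nontrivial relation
`u^{n₁} m₁ + u^{n₂} m₂ + u^{n₃} m₃ = 0` with constant coefficients. -/
theorem eventually_sum_ne_zero {n : ℕ → Fin 3 → Fin 2 → ℤ} (hn : MovesApart n)
    {m : Fin 3 → ExampleRing} (hm : m ≠ 0) :
    ∀ᶠ j in atTop, ∑ s, unitMono (n j s) * m s ≠ 0 := by
  by_contra hcon
  have hf : ∃ᶠ j in atTop, ∑ s, unitMono (n j s) * m s = 0 := by
    simpa [Filter.Frequently] using hcon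
  have := frequently_iff_neBot.1 hf
  -- An ultrafilter concentrated on the indices where the relation holds makes it hold eventually.
  obtain ⟨U, hUf⟩ := Ultrafilter.exists_le (atTop ⊓ 𝓟 {j | ∑ s, unitMono (n j s) * m s = 0})
  obtain ⟨hUle, hU'⟩ := le_inf_iff.1 hUf
  have hU : ∀ᶠ j in (U : Filter ℕ), ∑ s, unitMono (n j s) * m s = 0 := le_principal_iff.1 hU'
  choose k g hk using fun s => exists_ofPoly_eq (m s)
  -- A shift common to the three terms, large enough that all exponents stay nonnegative after the
  -- denominators `k s` are absorbed.
  let N : ℕ → Fin 2 → ℤ := fun j i => ∑ s, (|n j s i| + toExp (k s) i)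
  have hpos : ∀ j s i, 0 ≤ (n j s + N j - toExp (k s)) i := by
    intro j s i
    have h0 : ∀ s i, 0 ≤ toExp (k s) i := by
      intro s i; fin_cases i <;> simp [toExp]
    have h1 : |n j s i| + toExp (k s) i ≤ N j i :=
      Finset.single_le_sum (f := fun s => |n j s i| + toExp (k s) i)
        (fun s _ => add_nonneg (abs_nonneg _) (h0 s i)) (Finset.mem_univ s)
    have h2 := neg_abs_le (n j s i)
    simp only [Pi.add_apply, Pi.sub_apply]
    linarith
  let n' : ℕ → Fin 3 → ℕ × ℕ := fun j s => posPart (n j s + N j - toExp (k s))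
  have hn' : ∀ j s, toExp (n' j s) = n j s + N j - toExp (k s) := fun j s =>
    toExp_posPart_of_nonneg (hpos j s)
  have hg : g = 0 := by
    refine eq_zero_of_sum_mono_eq_zero U (n := n') ?_ ?_
    · intro s t hst a b
      have h1 : ∀ᶠ j in (U : Filter ℕ), n j s - n j t ≠
          toExp (k s) - toExp (k t) + toExp b - toExp a :=
        hUle ((hn s t hst).eventually (Set.finite_singleton _).compl_mem_cofinite)
      filter_upwards [h1] with j hj hab
      apply hj
      have h2 := congrArg toExp hab
      rw [toExp_add, toExp_add, hn', hn'] at h2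
      linear_combination h2
    · filter_upwards [hU] with j hj
      apply ofPoly_injective
      rw [map_sum, map_zero]
      calc ∑ s, ofPoly (g s * mono (n' j s))
          = unitMono (N j) * ∑ s, unitMono (n j s) * m s := by
            rw [Finset.mul_sum]
            refine Finset.sum_congr rfl fun s _ => ?_
            rw [map_mul, ofPoly_mono, hn', ← hk s]
            have : unitMono (n j s + N j - toExp (k s)) * unitMono (toExp (k s)) =
                unitMono (n j s) * unitMono (N j) := by
              rw [← unitMono_add, ← unitMono_add, sub_add_cancel]
            linear_combination (m s) * this
        _ = 0 := by rw [hj, mul_zero]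
  apply hm
  funext s
  have h := hk s
  rw [hg, Pi.zero_apply, map_zero] at h
  exact (isUnit_unitMono _).mul_right_eq_zero.1 h

end Ledrappier
end

noncomputable section

/-! ### Mixing in terms of characters -/

namespace DiscreteDual

variable {M : Type*} [AddCommGroup M]

instance : IsProbabilityMeasure (haar M) := ⟨haar_univ M⟩

instance : (haar M).IsHaarMeasure := by unfold haar; infer_instance

instance : (haar M).Regular := by unfold haar; infer_instance

/-- The character of the dual group that is the evaluation at `m`. -/
def ev (m : M) : C(DiscreteDual M, ℂ) where
  toFun x := (x (Multiplicative.ofAdd m : Multiplicative M) : Circle)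
  continuous_toFun := by
    refine continuous_subtype_val.comp ?_
    exact (continuous_eval_const (F := C(DiscreteMul M, Circle))
      (Multiplicative.ofAdd m : Multiplicative M)).comp
      (ContinuousMonoidHom.isInducing_toContinuousMap (DiscreteMul M) Circle).continuous

theorem ev_apply (m : M) (x : DiscreteDual M) :
    ev m x = (x (Multiplicative.ofAdd m : Multiplicative M) : Circle) := rfl

theorem ev_zero : ev (0 : M) = 1 := by
  ext x
  exact congrArg (fun z : Circle => (z : ℂ)) (map_one x)

theorem ev_add (a b : M) : ev (a + b) = ev a * ev b := by
  ext x
  have h : x (Multiplicative.ofAdd (a + b) : Multiplicative M) =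
    x (Multiplicative.ofAdd a : Multiplicative M) *
      x (Multiplicative.ofAdd b : Multiplicative M) := map_mul x _ _
  simp only [ev_apply, h, ContinuousMap.mul_apply, Circle.coe_mul]

theorem ev_sum {ι : Type*} (T : Finset ι) (m : ι → M) : ev (∑ s ∈ T, m s) = ∏ s ∈ T, ev (m s) := by
  classical
  induction T using Finset.induction_on with
  | empty => simp [ev_zero]
  | insert a T ha ih => rw [Finset.sum_insert ha, Finset.prod_insert ha, ev_add, ih]

theorem ev_apply_mul (m : M) (x y : DiscreteDual M) : ev m (x * y) = ev m x * ev m y := by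
  have h : (x * y) (Multiplicative.ofAdd m : Multiplicative M) =
    x (Multiplicative.ofAdd m : Multiplicative M) *
      y (Multiplicative.ofAdd m : Multiplicative M) := rfl
  simp only [ev_apply, h, Circle.coe_mul]

theorem ev_neg (m : M) : ev (-m) = star (ev m) := by
  ext x
  have h : x (Multiplicative.ofAdd (-m) : Multiplicative M) =
    (x (Multiplicative.ofAdd m : Multiplicative M))⁻¹ := map_inv x _
  simp only [ev_apply, h, ContinuousMap.star_apply, Circle.coe_inv_eq_conj]
  rfl

/-- The embedding of `ℚ / ℤ` in the circle. -/
def ratCircle : AddCircle (1 : ℚ) →+ Additive Circle :=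
  QuotientAddGroup.lift (AddSubgroup.zmultiples (1 : ℚ))
    { toFun := fun q => Additive.ofMul (Circle.exp (2 * Real.pi * q))
      map_zero' := by simp
      map_add' := fun a b => by
        rw [← ofMul_mul, ← Circle.exp_add]; push_cast; rw [mul_add] }
    (by
      rintro _ ⟨k, rfl⟩
      refine congrArg Additive.ofMul (Circle.exp_eq_one.2 ⟨k, ?_⟩)
      simp [mul_comm])

theorem ratCircle_ne_zero {a : AddCircle (1 : ℚ)} (ha : a ≠ 0) : ratCircle a ≠ 0 := by
  induction a using QuotientAddGroup.induction_on with
  | H q =>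
    intro h
    obtain ⟨k, hk⟩ := Circle.exp_eq_one.1 (show Circle.exp (2 * Real.pi * q) = 1 from h)
    have hq : (q : ℝ) = k := by
      have := Real.pi_pos
      field_simp at hk
      linarith
    have hq' : q = k := by exact_mod_cast hq
    apply ha
    rw [hq']
    exact (QuotientAddGroup.eq_zero_iff _).2 ⟨k, by simp⟩

/-- Characters into `ℚ/ℤ` separate points of any abelian group, and `ℚ/ℤ` embeds in the circle. -/
theorem exists_ev_ne_one {m : M} (hm : m ≠ 0) : ∃ x : DiscreteDual M, ev m x ≠ 1 := by
  obtain ⟨c, hc⟩ := CharacterModule.exists_character_apply_ne_zero_of_ne_zero hm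
  let f : Multiplicative M →* Circle := AddMonoidHom.toMultiplicativeLeft (ratCircle.comp c)
  let x : DiscreteMul M →ₜ* Circle := ⟨f, continuous_of_discreteTopology⟩
  refine ⟨x, fun h => ratCircle_ne_zero hc ?_⟩
  exact Circle.ext h

/-- Translating by `y` multiplies the integral by `ev m y ≠ 1`. -/
theorem integral_ev_of_ne_zero {m : M} (hm : m ≠ 0) : ∫ x, ev m x ∂(haar M) = 0 := by
  obtain ⟨y, hy⟩ := exists_ev_ne_one hm
  have h : ∫ x, ev m (y * x) ∂(haar M) = ∫ x, ev m x ∂(haar M) :=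
    integral_mul_left_eq_self (fun x => ev m x) y
  simp only [ev_apply_mul, integral_const_mul] at h
  by_contra h0
  exact hy (mul_right_cancel₀ h0 (h.trans (one_mul _).symm))

theorem integral_ev_zero : ∫ x, ev (0 : M) x ∂(haar M) = 1 := by
  simp [ev_zero]

/-! ### Density of trigonometric polynomials -/

/-- The algebra of trigonometric polynomials. -/
def trigSubalgebra (M : Type*) [AddCommGroup M] : StarSubalgebra ℂ C(DiscreteDual M, ℂ) where
  toSubalgebra := Algebra.adjoin ℂ (Set.range ev)
  star_mem' := by
    change Algebra.adjoin ℂ (Set.range ev) ≤ star (Algebra.adjoin ℂ (Set.range ev))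
    refine Algebra.adjoin_le ?_
    rintro - ⟨m, rfl⟩
    exact Algebra.subset_adjoin ⟨-m, ev_neg m⟩

theorem trigSubalgebra_toSubmodule :
    Subalgebra.toSubmodule (trigSubalgebra M).toSubalgebra = Submodule.span ℂ (Set.range ev) := by
  apply Algebra.adjoin_eq_span_of_subset
  refine Set.Subset.trans ?_ Submodule.subset_span
  intro x hx
  refine Submonoid.closure_induction (fun _ => id) ⟨0, ev_zero⟩ ?_ hx
  rintro - - - - ⟨m, rfl⟩ ⟨n, rfl⟩
  exact ⟨m + n, ev_add m n⟩

theorem trigSubalgebra_separatesPoints : (trigSubalgebra M).SeparatesPoints := by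
  intro x y hxy
  by_contra! hcon
  apply hxy
  apply PontryaginDual.ext
  intro a
  exact Circle.ext (hcon _ ⟨ev (Multiplicative.toAdd (a : Multiplicative M)),
    Algebra.subset_adjoin ⟨_, rfl⟩, rfl⟩)

/-- Trigonometric polynomials are dense in the space of continuous functions. -/
theorem exists_trig_near (f : C(DiscreteDual M, ℂ)) {ε : ℝ} (hε : 0 < ε) :
    ∃ g ∈ Submodule.span ℂ (Set.range (ev (M := M))), ∀ x, ‖f x - g x‖ ≤ ε := by
  have h := ContinuousMap.starSubalgebra_topologicalClosure_eq_top_of_separatesPoints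
    (trigSubalgebra M) trigSubalgebra_separatesPoints
  have hf : f ∈ (trigSubalgebra M).topologicalClosure := by rw [h]; trivial
  have hf' : f ∈ closure ((trigSubalgebra M : Set C(DiscreteDual M, ℂ))) := hf
  obtain ⟨g, hg, hfg⟩ := Metric.mem_closure_iff.1 hf' ε hε
  refine ⟨g, ?_, fun x => ?_⟩
  · rw [← trigSubalgebra_toSubmodule]; exact hg
  · rw [← dist_eq_norm]
    exact (ContinuousMap.dist_apply_le_dist x).trans hfg.le

/-- Indicator functions are approximated in mean by bounded trigonometric polynomials. -/
theorem exists_trig_near_indicator {A : Set (DiscreteDual M)} (hA : MeasurableSet A) {ε : ℝ}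
    (hε : 0 < ε) (hε1 : ε ≤ 1) :
    ∃ g ∈ Submodule.span ℂ (Set.range (ev (M := M))), (∀ x, ‖g x‖ ≤ 2) ∧
      ∫ x, ‖A.indicator (fun _ => (1 : ℂ)) x - g x‖ ∂(haar M) ≤ 3 * ε := by
  have hε' : ENNReal.ofReal ε ≠ 0 := by simpa using hε
  -- Three approximations, each costing `ε`: `A` by a closed `K`, its indicator by a continuous `f`
  -- with norm at most 1, and `f` uniformly by `g`.
  obtain ⟨K, hKA, hK, hKε⟩ := hA.exists_isClosed_sdiff_lt (measure_ne_top (haar M) A) hε'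
  obtain ⟨f, hf, hfK, hf1, -, -⟩ := exists_continuous_eLpNorm_sub_le_of_closed (μ := haar M)
    (p := 1) (by simp) hK isOpen_univ (Set.subset_univ K) (measure_ne_top _ _) (1 : ℂ) hε'
  obtain ⟨g, hg, hfg⟩ := exists_trig_near ⟨f, hf⟩ hε
  have hfi : Integrable f (haar M) := hf.integrable_of_hasCompactSupport
    (HasCompactSupport.of_compactSpace f)
  have hgi : Integrable g (haar M) := g.continuous.integrable_of_hasCompactSupport
    (HasCompactSupport.of_compactSpace g)
  have hKi : Integrable (K.indicator (fun _ => (1 : ℂ))) (haar M) :=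
    (integrable_const _).indicator hK.measurableSet
  have hAi : Integrable (A.indicator (fun _ => (1 : ℂ))) (haar M) :=
    (integrable_const _).indicator hA
  refine ⟨g, hg, fun x => ?_, ?_⟩
  · calc ‖g x‖ = ‖f x - (f x - g x)‖ := by rw [sub_sub_cancel]
      _ ≤ ‖f x‖ + ‖f x - g x‖ := norm_sub_le _ _
      _ ≤ 1 + ε := add_le_add (by simpa using hf1 x) (hfg x)
      _ ≤ 2 := by linarith
  · have h1 : ∫ x, ‖A.indicator (fun _ => (1 : ℂ)) x - K.indicator (fun _ => (1 : ℂ)) x‖ ∂(haar M)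
        ≤ ε := by
      have : (fun x => ‖A.indicator (fun _ => (1 : ℂ)) x - K.indicator (fun _ => (1 : ℂ)) x‖) =
          (A \ K).indicator (fun _ => (1 : ℝ)) := by
        funext x
        by_cases hxK : x ∈ K
        · simp [hxK, hKA hxK]
        · by_cases hxA : x ∈ A <;> simp [hxK, hxA]
      rw [this, integral_indicator (hA.diff hK.measurableSet)]
      simp only [integral_const, smul_eq_mul, mul_one, measureReal_restrict_apply_univ]
      exact ENNReal.toReal_le_of_le_ofReal hε.le hKε.le
    have h2 : ∫ x, ‖f x - K.indicator (fun _ => (1 : ℂ)) x‖ ∂(haar M) ≤ ε := by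
      refine (integral_norm_eq_lintegral_enorm (hfi.sub hKi).aestronglyMeasurable).trans_le ?_
      rw [eLpNorm_one_eq_lintegral_enorm] at hfK
      exact ENNReal.toReal_le_of_le_ofReal hε.le hfK
    have h3 : ∫ x, ‖f x - g x‖ ∂(haar M) ≤ ε := by
      calc ∫ x, ‖f x - g x‖ ∂(haar M) ≤ ∫ x, ε ∂(haar M) :=
            integral_mono (hfi.sub hgi).norm (integrable_const _) hfg
        _ = ε := by simp
    calc ∫ x, ‖A.indicator (fun _ => (1 : ℂ)) x - g x‖ ∂(haar M)
        ≤ ∫ x, (‖A.indicator (fun _ => (1 : ℂ)) x - K.indicator (fun _ => (1 : ℂ)) x‖ +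
            ‖f x - K.indicator (fun _ => (1 : ℂ)) x‖ + ‖f x - g x‖) ∂(haar M) := by
          refine integral_mono (hAi.sub hgi).norm
            (((hAi.sub hKi).norm.add (hfi.sub hKi).norm).add (hfi.sub hgi).norm) fun x => ?_
          simp only
          rw [norm_sub_rev (f x) (K.indicator _ x)]
          refine le_trans (le_of_eq ?_) ((norm_add_le _ _).trans
            (add_le_add_left (norm_add_le _ _) _))
          congr 1; ring
      _ ≤ ε + ε + ε := by
          refine (integral_add ((hAi.sub hKi).norm.add (hfi.sub hKi).norm)
            (hfi.sub hgi).norm).trans_le (add_le_add ?_ h3)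
          exact (integral_add (hAi.sub hKi).norm (hfi.sub hKi).norm).trans_le (add_le_add h1 h2)
      _ = 3 * ε := by ring

end DiscreteDual

theorem norm_prod_sub_prod_le_two_pow {ι : Type*} (T : Finset ι) {a b : ι → ℂ}
    (ha : ∀ s, ‖a s‖ ≤ 2) (hb : ∀ s, ‖b s‖ ≤ 2) :
    ‖∏ s ∈ T, a s - ∏ s ∈ T, b s‖ ≤ 2 ^ T.card * ∑ s ∈ T, ‖a s - b s‖ := by
  classical
  induction T using Finset.induction_on with
  | empty => simp
  | insert i T hi ih =>
    rw [Finset.prod_insert hi, Finset.prod_insert hi, Finset.sum_insert hi,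
      Finset.card_insert_of_notMem hi]
    have hB : ‖∏ s ∈ T, b s‖ ≤ 2 ^ T.card := by
      rw [norm_prod]
      exact (Finset.prod_le_prod (fun _ _ => norm_nonneg _) fun s _ => hb s).trans (by simp)
    have h1 : a i * ∏ s ∈ T, a s - b i * ∏ s ∈ T, b s =
        a i * (∏ s ∈ T, a s - ∏ s ∈ T, b s) + (a i - b i) * ∏ s ∈ T, b s := by ring
    rw [h1]
    refine (norm_add_le _ _).trans ?_
    rw [norm_mul, norm_mul]
    have h2 := mul_le_mul (ha i) ih (norm_nonneg _) zero_le_two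
    have h3 := mul_le_mul_of_nonneg_left hB (norm_nonneg (a i - b i))
    have h4 : 0 ≤ ‖a i - b i‖ * 2 ^ T.card := by positivity
    rw [pow_succ]
    linarith

/-! ### From character relations to mixing -/

section Mixing

open DiscreteDual

variable {d r : ℕ} {M : Type*} [AddCommGroup M] [Module (LaurentRing d) M]

theorem continuous_algebraicAction (n : Fin d → ℤ) : Continuous (algebraicAction M n) :=
  ContinuousMonoidHom.continuous_toFun _

theorem ev_algebraicAction (n : Fin d → ℤ) (m : M) (x : DiscreteDual M) :
    ev m (algebraicAction M n x) = ev (laurentMonomial n • m) x := rfl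

theorem tendsto_integral_prod_of_mem_span {n : ℕ → Fin r → Fin d → ℤ}
    (h : ∀ m : Fin r → M, m ≠ 0 →
      ∀ᶠ j in atTop, ∑ s, (laurentMonomial (n j s) : LaurentRing d) • m s ≠ 0)
    {g : Fin r → C(DiscreteDual M, ℂ)}
    (hg : ∀ s, g s ∈ Submodule.span ℂ (Set.range (ev (M := M)))) :
    Tendsto (fun j => ∫ x, ∏ s, g s (algebraicAction M (n j s) x) ∂(haar M)) atTop
      (𝓝 (∏ s, ∫ x, g s x ∂(haar M))) := by
  choose c hc using fun s => Finsupp.mem_span_range_iff_exists_finsupp.1 (hg s)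
  have hgx : ∀ s x, g s x = ∑ m ∈ (c s).support, c s m * ev m x := by
    intro s x
    rw [← hc s, Finsupp.sum, ContinuousMap.sum_apply]
    rfl
  have hint : ∀ f : C(DiscreteDual M, ℂ), Integrable f (haar M) := fun f =>
    f.continuous.integrable_of_hasCompactSupport (HasCompactSupport.of_compactSpace f)
  have h1 : ∀ j, ∫ x, ∏ s, g s (algebraicAction M (n j s) x) ∂(haar M) =
      ∑ p ∈ Fintype.piFinset fun s => (c s).support, (∏ s, c s (p s)) *
        ∫ x, ev (∑ s, (laurentMonomial (n j s) : LaurentRing d) • p s) x ∂(haar M) := by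
    intro j
    have : ∀ x, ∏ s, g s (algebraicAction M (n j s) x) =
        ∑ p ∈ Fintype.piFinset fun s => (c s).support, (∏ s, c s (p s)) *
          ev (∑ s, (laurentMonomial (n j s) : LaurentRing d) • p s) x := by
      intro x
      simp only [hgx, ev_algebraicAction]
      rw [Finset.prod_univ_sum]
      refine Finset.sum_congr rfl fun p _ => ?_
      rw [Finset.prod_mul_distrib, ev_sum, ContinuousMap.prod_apply]
    simp only [this]
    rw [integral_finsetSum _ fun p _ => (hint _).const_mul _]
    simp only [integral_const_mul]
  have h2 : ∏ s, ∫ x, g s x ∂(haar M) =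
      ∑ p ∈ Fintype.piFinset fun s => (c s).support, (∏ s, c s (p s)) *
        ∏ s, ∫ x, ev (p s) x ∂(haar M) := by
    have : ∀ s, ∫ x, g s x ∂(haar M) =
        ∑ m ∈ (c s).support, c s m * ∫ x, ev m x ∂(haar M) := by
      intro s
      simp only [hgx]
      rw [integral_finsetSum _ fun p _ => (hint _).const_mul _]
      simp only [integral_const_mul]
    simp only [this]
    rw [Finset.prod_univ_sum]
    exact Finset.sum_congr rfl fun p _ => Finset.prod_mul_distrib
  simp only [h1]
  rw [h2]
  refine tendsto_finsetSum _ fun p _ => Tendsto.const_mul _ ?_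
  -- Only the zero tuple contributes to the limit: for any other, both the product of integrals and,
  -- eventually, the joint integral vanish.
  by_cases hp : p = 0
  · subst hp
    simp [integral_ev_zero]
  · obtain ⟨s, hs⟩ := Function.ne_iff.1 hp
    rw [Finset.prod_eq_zero (Finset.mem_univ s) (integral_ev_of_ne_zero hs)]
    refine tendsto_const_nhds.congr' ?_
    filter_upwards [h p hp] with j hj
    rw [integral_ev_of_ne_zero hj]

/-- A sequence is mixing if no nontrivial relation `∑ₛ u^{nₛ} mₛ = 0` with constant coefficients
holds infinitely often along it. -/
theorem isMixingAlong_of_eventually_sum_ne_zero {n : ℕ → Fin r → Fin d → ℤ}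
    (h : ∀ m : Fin r → M, m ≠ 0 →
      ∀ᶠ j in atTop, ∑ s, (laurentMonomial (n j s) : LaurentRing d) • m s ≠ 0) :
    IsMixingAlong (haar M) (algebraicAction M) n := by
  intro A hA
  let F : Fin r → DiscreteDual M → ℂ := fun s => (A s).indicator fun _ => 1
  have hF1 : ∀ s x, ‖F s x‖ ≤ 1 := fun s x => by
    refine (norm_indicator_le_norm_self _ _).trans ?_
    simp
  have hFi : ∀ s, Integrable (F s) (haar M) := fun s => (integrable_const _).indicator (hA s)
  have hFint : ∀ s, ∫ x, F s x ∂(haar M) = ((haar M (A s)).toReal : ℂ) := fun s => by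
    simp [F, integral_indicator (hA s), Measure.real]
  have hα : ∀ j s, Measurable (algebraicAction M (n j s)) := fun j s =>
    (continuous_algebraicAction _).measurable
  have hprod : ∀ j x, ∏ s, F s (algebraicAction M (n j s) x) =
      (⋂ s, algebraicAction M (n j s) ⁻¹' A s).indicator (fun _ => (1 : ℂ)) x := by
    intro j x
    by_cases hx : x ∈ ⋂ s, algebraicAction M (n j s) ⁻¹' A s
    · rw [Set.indicator_of_mem hx]
      refine Finset.prod_eq_one fun s _ => ?_
      exact Set.indicator_of_mem (s := A s) (Set.mem_iInter.1 hx s) _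
    · rw [Set.indicator_of_notMem hx]
      obtain ⟨s, hs⟩ := not_forall.1 (mt Set.mem_iInter.2 hx)
      exact Finset.prod_eq_zero (Finset.mem_univ s) (Set.indicator_of_notMem (s := A s) hs _)
  have hms : ∀ j, MeasurableSet (⋂ s, algebraicAction M (n j s) ⁻¹' A s) := fun j =>
    MeasurableSet.iInter fun s => hα j s (hA s)
  have hprodint : ∀ j, ∫ x, ∏ s, F s (algebraicAction M (n j s) x) ∂(haar M) =
      ((haar M (⋂ s, algebraicAction M (n j s) ⁻¹' A s)).toReal : ℂ) := fun j => by
    simp only [hprod]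
    simp [integral_indicator (hms j), Measure.real]
  have hlim : Tendsto (fun j => ∫ x, ∏ s, F s (algebraicAction M (n j s) x) ∂(haar M)) atTop
      (𝓝 (∏ s, ∫ x, F s x ∂(haar M))) := by
    rw [Metric.tendsto_nhds]
    intro δ hδ
    have hC : (0 : ℝ) < 2 ^ r * (r + 1) * 12 := by positivity
    -- The factor 12 turns the error `3ε` per set into a total of at most `δ/4`; `r + 1` keeps the
    -- divisor positive when `r = 0`.
    obtain ⟨ε, hε, hε1, hεδ⟩ : ∃ ε : ℝ, 0 < ε ∧ ε ≤ 1 ∧ 2 ^ r * (r + 1) * 12 * ε ≤ δ :=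
      ⟨min 1 (δ / (2 ^ r * (r + 1) * 12)), lt_min one_pos (div_pos hδ hC), min_le_left _ _,
        (mul_le_mul_of_nonneg_left (min_le_right _ _) hC.le).trans_eq (mul_div_cancel₀ _ hC.ne')⟩
    have hbound : (2 : ℝ) ^ r * ∑ _s : Fin r, 3 * ε ≤ δ / 4 := by
      have : 0 ≤ (2 : ℝ) ^ r * ε := by positivity
      simp only [Finset.sum_const, Finset.card_univ, Fintype.card_fin, nsmul_eq_mul]
      linarith
    choose g hg hg2 hgε using fun s => exists_trig_near_indicator (hA s) hε hε1
    have hgi : ∀ s, Integrable (g s) (haar M) := fun s =>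
      (g s).continuous.integrable_of_hasCompactSupport (HasCompactSupport.of_compactSpace _)
    have hF2 : ∀ s x, ‖F s x‖ ≤ 2 := fun s x => (hF1 s x).trans one_le_two
    have hA1 : ‖∏ s, ∫ x, F s x ∂(haar M) - ∏ s, ∫ x, g s x ∂(haar M)‖ ≤ δ / 4 := by
      have hnorm : ∀ f : DiscreteDual M → ℂ, (∀ x, ‖f x‖ ≤ 2) → ‖∫ x, f x ∂(haar M)‖ ≤ 2 :=
        fun f hf => (norm_integral_le_of_norm_le_const (Eventually.of_forall hf)).trans (by simp)
      refine (norm_prod_sub_prod_le_two_pow Finset.univ (fun s => hnorm _ (hF2 s))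
        fun s => hnorm _ (hg2 s)).trans (le_trans ?_ hbound)
      rw [Finset.card_univ, Fintype.card_fin]
      refine mul_le_mul_of_nonneg_left (Finset.sum_le_sum fun s _ => ?_) (by positivity)
      rw [← integral_sub (hFi s) (hgi s)]
      exact (norm_integral_le_integral_norm _).trans (hgε s)
    have hA2 : ∀ j, ‖∫ x, ∏ s, F s (algebraicAction M (n j s) x) ∂(haar M) -
        ∫ x, ∏ s, g s (algebraicAction M (n j s) x) ∂(haar M)‖ ≤ δ / 4 := by
      intro j
      have hi1 : Integrable (fun x => ∏ s, F s (algebraicAction M (n j s) x)) (haar M) := by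
        simp only [hprod]
        exact (integrable_const _).indicator (hms j)
      have hi2 : Integrable (fun x => ∏ s, g s (algebraicAction M (n j s) x)) (haar M) := by
        refine Continuous.integrable_of_hasCompactSupport ?_ (HasCompactSupport.of_compactSpace _)
        exact continuous_finsetProd _ fun s _ =>
          (g s).continuous.comp (continuous_algebraicAction _)
      have hi3 : ∀ s, Integrable (fun x => ‖F s (algebraicAction M (n j s) x) -
          g s (algebraicAction M (n j s) x)‖) (haar M) := fun s =>
        ((measurePreserving_algebraicAction M (n j s)).integrable_comp_of_integrable
          ((hFi s).sub (hgi s))).norm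
      rw [← integral_sub hi1 hi2]
      refine (norm_integral_le_integral_norm _).trans (le_trans (b :=
        ∫ x, 2 ^ r * ∑ s, ‖F s (algebraicAction M (n j s) x) -
          g s (algebraicAction M (n j s) x)‖ ∂(haar M)) ?_ (le_trans ?_ hbound))
      · refine integral_mono (hi1.sub hi2).norm
          ((integrable_finsetSum _ fun s _ => hi3 s).const_mul _) fun x => ?_
        have h := norm_prod_sub_prod_le_two_pow Finset.univ
          (fun s => hF2 s (algebraicAction M (n j s) x))
          fun s => hg2 s (algebraicAction M (n j s) x)
        rwa [Finset.card_univ, Fintype.card_fin] at h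
      · rw [integral_const_mul, integral_finsetSum _ fun s _ => hi3 s]
        refine mul_le_mul_of_nonneg_left (Finset.sum_le_sum fun s _ => ?_) (by positivity)
        have hmp := measurePreserving_algebraicAction M (n j s)
        refine (le_of_eq ?_).trans (hgε s)
        have hmap := integral_map (μ := haar M) (φ := algebraicAction M (n j s))
          (f := fun x => ‖F s x - g s x‖) hmp.measurable.aemeasurable
          (by rw [hmp.map_eq]; exact ((hFi s).sub (hgi s)).norm.aestronglyMeasurable)
        rw [hmp.map_eq] at hmap
        exact hmap.symm
    filter_upwards [Metric.tendsto_nhds.1 (tendsto_integral_prod_of_mem_span h hg) (δ / 4)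
      (by positivity)] with j hj
    rw [dist_eq_norm] at hj ⊢
    have hA1' := hA1
    rw [norm_sub_rev] at hA1'
    refine lt_of_le_of_lt (norm_sub_le_norm_sub_add_norm_sub _
      (∫ x, ∏ s, g s (algebraicAction M (n j s) x) ∂(haar M)) _) ?_
    have h3 := norm_sub_le_norm_sub_add_norm_sub
      (∫ x, ∏ s, g s (algebraicAction M (n j s) x) ∂(haar M))
      (∏ s, ∫ x, g s x ∂(haar M)) (∏ s, ∫ x, F s x ∂(haar M))
    have h4 := hA2 j
    linarith
  simp only [hprodint, hFint] at hlim
  rw [← Complex.ofReal_prod, ← ENNReal.toReal_prod] at hlim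
  have hlim' := (Complex.continuous_re.tendsto _).comp hlim
  refine (ENNReal.tendsto_toReal_iff (fun j => measure_ne_top _ _)
    (ENNReal.prod_ne_top fun s _ => measure_ne_top _ _)).1 ?_
  simpa only [Function.comp_def, Complex.ofReal_re] using hlim'

end Mixing
end

noncomputable section

/-! ### The order of mixing -/

namespace Ledrappier

open DiscreteDual

/-- Four points of `ℤ²` that carry the relation `1 + u₁ + u₂ + u₂² = 0`, followed by further
points of the first coordinate axis. -/
def relationPoint (s : ℕ) : Fin 2 → ℤ :=
  if s = 2 then ![0, 1] else if s = 3 then ![0, 2] else ![(s : ℤ), 0]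

theorem relationPoint_injective : Function.Injective relationPoint := by
  intro s t h
  have h0 := congrFun h 0
  have h1 := congrFun h 1
  unfold relationPoint at h0 h1
  split_ifs at h0 h1 <;> simp at h0 h1 <;> omega

theorem movesApart_relationPoint (r : ℕ) :
    MovesApart fun (j : ℕ) (s : Fin r) => 2 ^ j • relationPoint s := by
  intro s t hst
  have hne : relationPoint s - relationPoint t ≠ 0 := fun h =>
    hst (Fin.ext (relationPoint_injective (sub_eq_zero.1 h)))
  have hinj : Function.Injective fun j : ℕ =>
      2 ^ j • relationPoint s - 2 ^ j • relationPoint t := by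
    intro i j hij
    simp only [← smul_sub] at hij
    obtain ⟨k, hk⟩ := Function.ne_iff.1 hne
    have h := congrFun hij k
    simp only [Pi.smul_apply, nsmul_eq_mul] at h
    exact Nat.pow_right_injective le_rfl (by exact_mod_cast mul_right_cancel₀ hk h)
  rw [← Nat.cofinite_eq_atTop]
  exact hinj.tendsto_cofinite

/-- The case `j = 0` is the defining relation; the `2^j`-th power map is additive in characteristic
2. -/
theorem relationPoint_relation (j : ℕ) :
    unitMono (2 ^ j • relationPoint 0) + unitMono (2 ^ j • relationPoint 1) +
      unitMono (2 ^ j • relationPoint 2) + unitMono (2 ^ j • relationPoint 3) = 0 := by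
  have h : unitMono (relationPoint 0) + unitMono (relationPoint 1) +
      unitMono (relationPoint 2) + unitMono (relationPoint 3) = 0 := by
    rw [← exampleRing_relation, ← unitMono_nsmul, ← unitMono_zero]
    congr 4 <;> ext i <;> fin_cases i <;> simp [relationPoint]
  simp only [unitMono_nsmul]
  rw [← add_pow_expChar_pow, ← add_pow_expChar_pow, ← add_pow_expChar_pow, h]
  exact zero_pow (pow_ne_zero _ two_ne_zero)

/-- The characters that are trivial at `1`. -/
def evOneSet : Set (DiscreteDual ExampleRing) := {x | ev (1 : ExampleRing) x = 1}

theorem ev_sq (m : ExampleRing) (x : DiscreteDual ExampleRing) : ev m x * ev m x = 1 := by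
  rw [← ContinuousMap.mul_apply, ← ev_add, CharTwo.add_self_eq_zero, ev_zero]; rfl

theorem isClosed_evOneSet : IsClosed evOneSet :=
  isClosed_eq (ev (1 : ExampleRing)).continuous continuous_const

/-- Since `2 = 0` in the module, characters take only the values `±1`; the set is clopen, so it and
its complement have positive Haar measure. -/
theorem isOpen_evOneSet : IsOpen evOneSet := by
  have : evOneSet = {x | ev (1 : ExampleRing) x = -1}ᶜ := by
    ext x
    simp only [evOneSet, Set.mem_ofPred_eq, Set.mem_compl_iff]
    rcases mul_self_eq_one_iff.1 (ev_sq 1 x) with h | h <;> rw [h]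
    · simpa using (by norm_num : (1 : ℂ) ≠ -1)
    · simpa using (by norm_num : (-1 : ℂ) ≠ 1)
  rw [this]
  exact (isClosed_eq (ev (1 : ExampleRing)).continuous continuous_const).isOpen_compl

theorem haar_evOneSet_ne_zero : haar ExampleRing evOneSet ≠ 0 :=
  (isOpen_evOneSet.measure_pos _ ⟨1, rfl⟩).ne'

theorem haar_compl_evOneSet_ne_zero : haar ExampleRing evOneSetᶜ ≠ 0 :=
  (isClosed_evOneSet.isOpen_compl.measure_pos _ (exists_ev_ne_one one_ne_zero)).ne'

theorem mem_preimage_evOneSet {n : Fin 2 → ℤ} {x : DiscreteDual ExampleRing} :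
    algebraicAction (d := 2) ExampleRing n x ∈ evOneSet ↔ ev (unitMono n) x = 1 := by
  rw [evOneSet, Set.mem_ofPred_eq, ev_algebraicAction, smul_eq_unitMono_mul, mul_one]

theorem not_mixingOfOrder {r : ℕ} (hr : 3 < r) :
    ¬ MixingOfOrder (haar ExampleRing) (algebraicAction (d := 2) ExampleRing) r := by
  intro hmix
  -- The relation forces the fourth character to be 1 when the first three are, so these sets never
  -- meet; the remaining coordinates impose nothing.
  let A : Fin r → Set (DiscreteDual ExampleRing) := fun s =>
    if (s : ℕ) < 3 then evOneSet else if (s : ℕ) = 3 then evOneSetᶜ else Set.univ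
  have hA : ∀ s, MeasurableSet (A s) := by
    intro s
    simp only [A]
    split_ifs
    exacts [isClosed_evOneSet.measurableSet, isClosed_evOneSet.measurableSet.compl, .univ]
  have hlim := hmix _ (movesApart_relationPoint r) A hA
  have hempty : ∀ j : ℕ, ⋂ s : Fin r,
      algebraicAction (d := 2) ExampleRing (2 ^ j • relationPoint s) ⁻¹' A s = ∅ := by
    intro j
    rw [Set.eq_empty_iff_forall_notMem]
    intro x hx
    rw [Set.mem_iInter] at hx
    have h0 : ev (unitMono (2 ^ j • relationPoint 0)) x = 1 :=
      mem_preimage_evOneSet.1 (hx ⟨0, by omega⟩)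
    have h1 : ev (unitMono (2 ^ j • relationPoint 1)) x = 1 :=
      mem_preimage_evOneSet.1 (hx ⟨1, by omega⟩)
    have h2 : ev (unitMono (2 ^ j • relationPoint 2)) x = 1 :=
      mem_preimage_evOneSet.1 (hx ⟨2, by omega⟩)
    have h3 : algebraicAction (d := 2) ExampleRing (2 ^ j • relationPoint 3) x ∈ evOneSetᶜ :=
      hx ⟨3, hr⟩
    apply h3
    rw [mem_preimage_evOneSet]
    have h := congrArg (fun m => ev m x) (relationPoint_relation j)
    simp only [ev_add, ev_zero, ContinuousMap.mul_apply, ContinuousMap.one_apply] at h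
    simpa only [h0, h1, h2, one_mul] using h
  simp only [hempty, measure_empty] at hlim
  have h0 := tendsto_nhds_unique tendsto_const_nhds hlim
  obtain ⟨s, -, hs⟩ := Finset.prod_eq_zero_iff.1 h0.symm
  simp only [A] at hs
  split_ifs at hs
  · exact haar_evOneSet_ne_zero hs
  · exact haar_compl_evOneSet_ne_zero hs
  · simp at hs

theorem mixingOfOrder_three :
    MixingOfOrder (haar ExampleRing) (algebraicAction (d := 2) ExampleRing) 3 := by
  intro n hn
  refine isMixingAlong_of_eventually_sum_ne_zero fun m hm => ?_
  simpa only [smul_eq_unitMono_mul] using eventually_sum_ne_zero hn hm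

end Ledrappier

end

theorem mainTheorem6 :
    HasOrderOfMixing (DiscreteDual.haar (LaurentRing 2 ⧸ exampleIdeal))
      (algebraicAction (d := 2) (LaurentRing 2 ⧸ exampleIdeal)) 3 :=
  ⟨Ledrappier.mixingOfOrder_three, fun _ hr =>
    not_lt.1 fun h => Ledrappier.not_mixingOfOrder h hr⟩
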